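/- **Theorem (Generic flatness).** Let $f\colon X\to Y$ be a morphism of finite type between Noetherian schemes, with $Y$ reduced and non-empty, and let $\mathscr F$ be a coherent sheaf on $X$, i.e. an $\mathscr O_X$-module such that $X$ is covered by affine open subsets $V=\operatorname{Spec} B$ on each of which $\mathscr F|_V\cong\widetilde M$ for some finitely generated $B$-module $M$. Then there is a non-empty open subset $U\subseteq Y$ such that $\mathscr F|_{f^{-1}U}$ is flat over $U$; that is, for every $x\in f^{-1}U$ the stalk $\mathscr F_x$, regarded as a module over $\mathscr O_{Y,f(x)}$ through the ring homomorphism $\mathscr O_{Y,f(x)}\to\mathscr O_{X,x}$ induced by $f$, is a flat $\mathscr O_{Y,f(x)}$-module. -/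

import Mathlib

open CategoryTheory AlgebraicGeometry TopologicalSpace

universe u

namespace AlgebraicGeometry.Scheme.Modules

/-- The module structure of the stalk `F_x` over the local ring `𝒪_{X,x}`; it is the one with
`germ (r • m) = germ r • germ m`, see `germ_smul_stalk`. -/
noncomputable instance stalkModule {X : Scheme.{u}} (F : X.Modules) (x : X) :
    Module (X.presheaf.stalk x) ↑(TopCat.Presheaf.stalk F.presheaf x) :=
  letI P : _root_.PresheafOfModules.{u} (X.presheaf ⋙ forget₂ CommRingCat RingCat) := F.val
  inferInstanceAs (Module (X.presheaf.stalk x) ↑(TopCat.Presheaf.stalk P.presheaf x))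

lemma germ_smul_stalk {X : Scheme.{u}} (F : X.Modules) (x : X) (U : X.Opens) (hx : x ∈ U)
    (r : Γ(X, U)) (m : Γ(F, U)) :
    TopCat.Presheaf.germ F.presheaf U x hx (r • m) =
      X.presheaf.germ U x hx r • TopCat.Presheaf.germ F.presheaf U x hx m :=
  PresheafOfModules.germ_smul (R := X.presheaf) F.val x U hx r m

/-- A coherent sheaf: `X` is covered by affine opens `U = Spec A` on which `F` is isomorphic to
the sheaf `M^~` associated with a finitely generated `A`-module `M`. -/
def IsCoherent {X : Scheme.{u}} (F : X.Modules) : Prop :=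
  ∀ x : X, ∃ (U : X.Opens) (hU : IsAffineOpen U), x ∈ U ∧
    ∃ M : ModuleCat.{u} Γ(X, U), Module.Finite Γ(X, U) M ∧
      Nonempty (F.restrict hU.fromSpec ≅ tilde M)

/-- `F` is flat at `x` over `Y`: the stalk `F_x`, an `𝒪_{Y,f(x)}`-module through
`𝒪_{Y,f(x)} ⟶ 𝒪_{X,x}`, is flat. -/
def IsFlatAt {X Y : Scheme.{u}} (f : X ⟶ Y) (F : X.Modules) (x : X) : Prop :=
  letI : Module (Y.presheaf.stalk (f x)) ↑(TopCat.Presheaf.stalk F.presheaf x) :=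
    Module.compHom ↑(TopCat.Presheaf.stalk F.presheaf x) (f.stalkMap x).hom
  Module.Flat (Y.presheaf.stalk (f x)) ↑(TopCat.Presheaf.stalk F.presheaf x)

/-- `F` is flat over `Y`. -/
def IsFlatOver {X Y : Scheme.{u}} (f : X ⟶ Y) (F : X.Modules) : Prop :=
  ∀ x : X, IsFlatAt f F x

end AlgebraicGeometry.Scheme.Modules

/-! Let `A` be the ring of an affine open of `Y` and `p` a minimal prime. As `A` is reduced, `A_p`
is a field, so a finite `A`-module is free at `p`, hence flat after inverting some `a ∉ p`
(`of_finite`). This extends to finite modules over `A[x₁, …, xₙ]` one variable at a time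
(`polynomial`). A finite `B[X]`-module is the union of the stages `N + X N + ⋯ + X ^ k N`, with `N`
finite over `B`. The successive quotients are `N ⧸ K k` with `K` ascending, so by Noetherianity only
finitely many occur and one `a` serves them all; extensions and unions preserve flatness. On the
scheme, `F_x` is a localization of such a module, so it is flat over `A` and then over `𝒪_{Y,f(x)}`
wherever `a` is invertible. Quasi-compactness leaves finitely many `a`, which are multiplied. -/

namespace Module.Flat

/-! ### Flatness criteria -/

lemma isTrivialRelation_map {A M N : Type*} [CommRing A] [AddCommGroup M] [Module A M]
    [AddCommGroup N] [Module A N] (φ : M →ₗ[A] N) {l : ℕ} {f : Fin l → A} {x : Fin l → M}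
    (h : IsTrivialRelation f x) : IsTrivialRelation f (fun i ↦ φ (x i)) := by
  obtain ⟨k, a, y, hx, ha⟩ := h
  exact ⟨k, a, fun j ↦ φ (y j), fun i ↦ by simp [hx i], ha⟩

/-- A module is flat if every finite family of its elements lies in a flat submodule. -/
lemma of_forall_exists_submodule {A M : Type*} [CommRing A] [AddCommGroup M] [Module A M]
    (h : ∀ (l : ℕ) (x : Fin l → M), ∃ N : Submodule A M, Module.Flat A N ∧ ∀ i, x i ∈ N) :
    Module.Flat A M := by
  refine of_forall_isTrivialRelation fun {l f x} hfx ↦ ?_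
  obtain ⟨N, hN, hx⟩ := h l x
  have : ∑ i, f i • (⟨x i, hx i⟩ : N) = 0 := Subtype.ext (by simpa using hfx)
  exact isTrivialRelation_map N.subtype (isTrivialRelation_of_sum_smul_eq_zero this)

/-- An extension of flat modules is flat. -/
lemma of_exact {A N M Q : Type*} [CommRing A] [AddCommGroup N] [Module A N] [AddCommGroup M]
    [Module A M] [AddCommGroup Q] [Module A Q] {f : N →ₗ[A] M} {g : M →ₗ[A] Q}
    (hf : Function.Injective f) (hfg : Function.Exact f g) (hg : Function.Surjective g)
    [Module.Flat A N] [Module.Flat A Q] : Module.Flat A M := by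
  refine ((tfae_equational_criterion A M).out 0 1).mpr fun I ↦ ?_
  rw [injective_iff_map_eq_zero]
  intro z hz
  have hQ : Function.Injective (I.subtype.rTensor Q) :=
    rTensor_preserves_injective_linearMap _ I.injective_subtype
  have hN : Function.Injective (I.subtype.rTensor N) :=
    rTensor_preserves_injective_linearMap _ I.injective_subtype
  have hAf : Function.Injective (f.lTensor A) := lTensor_preserves_injective_linearMap _ hf
  -- Chase from `I ⊗ -` to `A ⊗ -`: `z` dies in `I ⊗ Q`, so it comes from some `w` in `I ⊗ N`, and
  -- `I ⊗ N → A ⊗ N → A ⊗ M` is injective.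
  have hz' : g.lTensor I z = 0 := hQ <| by
    rw [← LinearMap.comp_apply, LinearMap.rTensor_comp_lTensor, ← LinearMap.lTensor_comp_rTensor,
      LinearMap.comp_apply, hz, map_zero, map_zero]
  obtain ⟨w, rfl⟩ := (_root_.lTensor_exact I hfg hg z).mp hz'
  rw [← LinearMap.comp_apply, LinearMap.rTensor_comp_lTensor, ← LinearMap.lTensor_comp_rTensor,
    LinearMap.comp_apply] at hz
  rw [hN (hAf (hz.trans (map_zero _).symm) |>.trans (map_zero _).symm), map_zero]

/-- Let `N'` be a localization of the `B`-module `N`, for an `A`-algebra `B`. If `a ∈ A` acts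
invertibly on `N'` and `N_a` is flat over `A`, then `N'` is flat over `A`. -/
lemma of_isLocalizedModule_of_away {A B N N' : Type*} [CommRing A] [CommRing B] [Algebra A B]
    [AddCommGroup N] [Module A N] [Module B N] [IsScalarTower A B N]
    [AddCommGroup N'] [Module A N'] [Module B N'] [IsScalarTower A B N']
    (S : Submonoid B) (φ : N →ₗ[B] N') [IsLocalizedModule S φ] (a : A)
    (ha : IsUnit (algebraMap A (Module.End A N') a))
    [Module.Flat A (LocalizedModule (.powers a) N)] : Module.Flat A N' := by
  refine of_forall_isTrivialRelation fun {l f x} hfx ↦ ?_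
  -- The element `b` clears denominators and `c` below makes the relation hold in `N` itself. It
  -- becomes trivial in `N_a`; map this to `N'` and divide by `c * b`.
  obtain ⟨b, hb⟩ := IsLocalizedModule.exist_integer_multiples_of_finite S φ x
  choose y hy using hb
  have hφ : φ (∑ i, f i • y i) = 0 := by
    have : ∑ i, f i • φ (y i) = (b : B) • ∑ i, f i • x i := by
      rw [Finset.smul_sum]
      exact Finset.sum_congr rfl fun i _ ↦ by rw [hy i, smul_comm]
    rw [hfx, smul_zero] at this
    rw [map_sum, ← this]
    exact Finset.sum_congr rfl fun i _ ↦ (φ.restrictScalars A).map_smul _ _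
  obtain ⟨c, hc⟩ := (IsLocalizedModule.eq_zero_iff S φ).mp hφ
  have hN : ∑ i, f i • ((c : B) • y i) = 0 := by
    rw [← hc, Submonoid.smul_def, Finset.smul_sum]
    exact Finset.sum_congr rfl fun i _ ↦ smul_comm _ _ _
  have hunit : ∀ t : Submonoid.powers a, IsUnit (algebraMap A (Module.End A N') t) := by
    rintro ⟨_, n, rfl⟩
    simpa using ha.pow n
  have hNa : ∑ i, f i • LocalizedModule.mkLinearMap (.powers a) N ((c : B) • y i) = 0 := by
    simpa only [map_sum, map_smul, map_zero] using
      congr(LocalizedModule.mkLinearMap (.powers a) N $hN)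
  have key := isTrivialRelation_map
    (LocalizedModule.lift (.powers a) (φ.restrictScalars A) hunit)
    (isTrivialRelation_of_sum_smul_eq_zero hNa)
  obtain ⟨u, hu⟩ := IsLocalizedModule.map_units φ (c * b)
  convert isTrivialRelation_map (((↑u⁻¹ : Module.End B N')).restrictScalars A) key using 2 with i
  have h1 : LocalizedModule.lift (.powers a) (φ.restrictScalars A) hunit
      (LocalizedModule.mkLinearMap (.powers a) N ((c : B) • y i)) =
        (u : Module.End B N') (x i) := by
    rw [← LinearMap.comp_apply, LocalizedModule.lift_comp, hu, LinearMap.restrictScalars_apply,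
      map_smul, hy i]
    simp [smul_comm (c : B) (b : B)]
  rw [h1, LinearMap.restrictScalars_apply, ← Module.End.mul_apply, Units.inv_mul,
    Module.End.one_apply]


/-! ### Flatness after inverting one element -/

section Away

variable {A : Type*} [CommRing A] {M N Q : Type*} [AddCommGroup M] [Module A M] [AddCommGroup N]
  [Module A N] [AddCommGroup Q] [Module A Q]

/-- A divisor of `b` acts invertibly on `M_b`. This allows several witnesses to be replaced by their
product. -/
lemma localizedModule_of_dvd {a b : A} (hab : a ∣ b)
    [Module.Flat A (LocalizedModule (.powers a) M)] :
    Module.Flat A (LocalizedModule (.powers b) M) := by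
  refine of_isLocalizedModule_of_away (.powers b) (LocalizedModule.mkLinearMap (.powers b) M) a ?_
  obtain ⟨c, rfl⟩ := hab
  have := IsLocalizedModule.map_units (LocalizedModule.mkLinearMap (.powers (a * c)) M)
    ⟨a * c, Submonoid.mem_powers _⟩
  rw [map_mul, (Commute.all a c).map (algebraMap A _) |>.isUnit_mul_iff] at this
  exact this.1

lemma localizedModule_of_linearEquiv (S : Submonoid A) (e : M ≃ₗ[A] N)
    [Module.Flat A (LocalizedModule S N)] : Module.Flat A (LocalizedModule S M) :=
  of_linearEquiv (IsLocalizedModule.linearEquiv S (LocalizedModule.mkLinearMap S M)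
    (LocalizedModule.mkLinearMap S N ∘ₗ e.toLinearMap))

lemma localizedModule_of_exact (S : Submonoid A) {f : N →ₗ[A] M} {g : M →ₗ[A] Q}
    (hf : Function.Injective f) (hfg : Function.Exact f g) (hg : Function.Surjective g)
    [Module.Flat A (LocalizedModule S N)] [Module.Flat A (LocalizedModule S Q)] :
    Module.Flat A (LocalizedModule S M) :=
  of_exact (f := (LocalizedModule.map S f).restrictScalars A)
    (g := (LocalizedModule.map S g).restrictScalars A)
    (LocalizedModule.map_injective S f hf) (LocalizedModule.map_exact S f g hfg)
    (LocalizedModule.map_surjective S g hg)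

lemma localizedModule_of_iUnion (S : Submonoid A) (P : ℕ → Submodule A M) (hP : Monotone P)
    (hM : ∀ m, ∃ k, m ∈ P k) (h : ∀ k, Module.Flat A (LocalizedModule S (P k))) :
    Module.Flat A (LocalizedModule S M) := by
  refine of_forall_exists_submodule fun l x ↦ ?_
  let j (k : ℕ) : LocalizedModule S (P k) →ₗ[A] LocalizedModule S M :=
    (LocalizedModule.map S (P k).subtype).restrictScalars A
  have hj (k : ℕ) : Function.Injective (j k) :=
    LocalizedModule.map_injective S _ (P k).injective_subtype
  have hx (i : Fin l) : ∃ (m : M) (s : S), x i = LocalizedModule.mk m s := by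
    induction x i with | _ m s => exact ⟨m, s, rfl⟩
  choose m s hms using hx
  choose k hk using fun i ↦ hM (m i)
  let K := Finset.univ.sup k
  refine ⟨LinearMap.range (j K), of_linearEquiv (LinearEquiv.ofInjective _ (hj K)).symm,
    fun i ↦ ⟨LocalizedModule.mk ⟨m i, hP (Finset.le_sup (Finset.mem_univ i)) (hk i)⟩ (s i), ?_⟩⟩
  simp [j, hms i, LocalizedModule.map_mk]

end Away

end Module.Flat

/-! ### Generic flatness of modules -/

namespace Module

/-- An `A`-module `M` is generically flat at the prime ideal `p` if `M_a` is flat over `A` for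
some `a ∉ p`. -/
def GenericallyFlat {A : Type*} [CommRing A] (p : Ideal A) (M : Type*) [AddCommGroup M]
    [Module A M] : Prop :=
  ∃ a ∉ p, Module.Flat A (LocalizedModule (.powers a) M)

namespace GenericallyFlat

variable {A : Type*} [CommRing A] {p : Ideal A}

lemma exists_forall_of_finite [p.IsPrime] {ι : Type*} [Finite ι] (M : ι → Type*)
    [∀ i, AddCommGroup (M i)] [∀ i, Module A (M i)] (h : ∀ i, GenericallyFlat p (M i)) :
    ∃ a ∉ p, ∀ i, Module.Flat A (LocalizedModule (.powers a) (M i)) := by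
  cases nonempty_fintype ι
  choose a ha h using h
  exact ⟨∏ i, a i, fun hmem ↦ by
    simpa [ha] using Ideal.IsPrime.prod_mem_iff.mp hmem, fun i ↦
    have := h i; Flat.localizedModule_of_dvd (Finset.dvd_prod_of_mem a (Finset.mem_univ i))⟩

/-- A finite module is generically flat at a prime whose local ring is a field. -/
lemma of_finite [IsNoetherianRing A] [p.IsPrime] (hp : IsField (Localization.AtPrime p))
    (M : Type*) [AddCommGroup M] [Module A M] [Module.Finite A M] : GenericallyFlat p M := by
  have : Module.FinitePresentation A M := Module.finitePresentation_of_finite A M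
  have hmem : (⟨p, ‹_›⟩ : PrimeSpectrum A) ∈ freeLocus A M := by
    rw [mem_freeLocus]
    let := hp.toField
    exact Module.Free.of_divisionRing _ _
  -- The free locus is open, so it contains a basic open neighbourhood `D(a)` of `p`, over which
  -- `M_a` is locally free.
  obtain ⟨_, ⟨a, rfl⟩, ha, hsub⟩ :=
    PrimeSpectrum.isTopologicalBasis_basic_opens.exists_subset_of_mem_open hmem isOpen_freeLocus
  have := basicOpen_subset_freeLocus_iff.mp hsub
  exact ⟨a, ha, .trans A (Localization.Away a) _⟩

/-- By the isomorphism theorem `(P + im φ) / P ≃ N / φ⁻¹(P)`, so the sum is an extension of two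
modules with flat localization. -/
lemma _root_.Module.Flat.localizedModule_sup_range {B M N : Type*} [CommRing B] [Algebra A B]
    [AddCommGroup M] [Module A M] [Module B M] [IsScalarTower A B M]
    [AddCommGroup N] [Module A N] [Module B N] [IsScalarTower A B N] (S : Submonoid A)
    (P : Submodule B M) (φ : N →ₗ[B] M) [Module.Flat A (LocalizedModule S P)]
    [Module.Flat A (LocalizedModule S (N ⧸ P.comap φ))] :
    Module.Flat A (LocalizedModule S ↥(P ⊔ LinearMap.range φ)) := by
  let Q := P ⊔ LinearMap.range φ
  let P' : Submodule B Q := P.comap Q.subtype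
  let ψ : N →ₗ[B] Q ⧸ P' :=
    P'.mkQ ∘ₗ φ.codRestrict Q fun n ↦ Submodule.mem_sup_right ⟨n, rfl⟩
  have hψ : Function.Surjective ψ := by
    intro z
    obtain ⟨⟨z, hz⟩, rfl⟩ := P'.mkQ_surjective z
    obtain ⟨y, hy, _, ⟨n, rfl⟩, rfl⟩ := Submodule.mem_sup.mp hz
    refine ⟨n, (Submodule.Quotient.eq P').mpr ?_⟩
    simpa [P'] using hy
  have hker : LinearMap.ker ψ = P.comap φ := by
    ext n
    simp [ψ, P']
  let e : (Q ⧸ P') ≃ₗ[B] N ⧸ P.comap φ :=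
    (ψ.quotKerEquivOfSurjective hψ).symm ≪≫ₗ Submodule.quotEquivOfEq _ _ hker
  have : Module.Flat A (LocalizedModule S (Q ⧸ P')) :=
    Flat.localizedModule_of_linearEquiv S (e.restrictScalars A)
  refine Flat.localizedModule_of_exact S
    (f := (Submodule.inclusion (le_sup_left : P ≤ Q)).restrictScalars A)
    (g := P'.mkQ.restrictScalars A) (Submodule.inclusion_injective le_sup_left) ?_ P'.mkQ_surjective
  intro z
  simp [P', Submodule.inclusion, Subtype.ext_iff]

/-! ### Adjoining one variable -/

section Polynomial

open Polynomial

variable {B : Type*} [CommRing B] {M : Type*} [AddCommGroup M]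
  [Module B M] [Module B[X] M] [IsScalarTower B B[X] M]

/-- The `B`-submodule `N + X N + ⋯ + X ^ k N` of a `B[X]`-module. -/
noncomputable def powFiltration (N : Submodule B M) : ℕ → Submodule B M
  | 0 => N
  | k + 1 => powFiltration N k ⊔
      LinearMap.range (Algebra.lsmul B B M (X ^ (k + 1) : B[X]) ∘ₗ N.subtype)

lemma powFiltration_mono (N : Submodule B M) : Monotone (powFiltration N) :=
  monotone_nat_of_le_succ fun _ ↦ le_sup_left

lemma X_smul_mem_powFiltration {N : Submodule B M} {k : ℕ} {m : M} (hm : m ∈ powFiltration N k) :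
    (X : B[X]) • m ∈ powFiltration N (k + 1) := by
  induction k generalizing m with
  | zero => exact Submodule.mem_sup_right ⟨⟨m, hm⟩, by simp⟩
  | succ k ih =>
    obtain ⟨y, hy, _, ⟨n, rfl⟩, rfl⟩ := Submodule.mem_sup.mp hm
    rw [smul_add]
    refine add_mem (powFiltration_mono N (Nat.le_succ _) (ih hy))
      (Submodule.mem_sup_right ⟨n, ?_⟩)
    simp [pow_succ' X (k + 1)]

lemma exists_mem_powFiltration {N : Submodule B M} (hN : Submodule.span B[X] (N : Set M) = ⊤)
    (m : M) : ∃ k, m ∈ powFiltration N k := by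
  have hadd {x y : M} (hx : ∃ k, x ∈ powFiltration N k) (hy : ∃ k, y ∈ powFiltration N k) :
      ∃ k, x + y ∈ powFiltration N k := by
    obtain ⟨k, hk⟩ := hx
    obtain ⟨l, hl⟩ := hy
    exact ⟨max k l, add_mem (powFiltration_mono N (le_max_left _ _) hk)
      (powFiltration_mono N (le_max_right _ _) hl)⟩
  have hm : m ∈ Submodule.span B[X] (N : Set M) := hN ▸ Submodule.mem_top
  induction hm using Submodule.span_induction with
  | mem x hx => exact ⟨0, hx⟩
  | zero => exact ⟨0, zero_mem _⟩
  | add x y _ _ hx hy => exact hadd hx hy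
  | smul q x _ hx =>
    induction q using Polynomial.induction_on' with
    | add q r hq hr => rw [add_smul]; exact hadd hq hr
    | monomial n b =>
      obtain ⟨k, hk⟩ := hx
      refine ⟨k + n, ?_⟩
      have hX : (X ^ n : B[X]) • x ∈ powFiltration N (k + n) := by
        induction n with
        | zero => simpa using hk
        | succ n ih =>
          rw [pow_succ', mul_smul]
          exact X_smul_mem_powFiltration ih
      rw [← C_mul_X_pow_eq_monomial, ← smul_eq_C_mul, smul_assoc]
      exact Submodule.smul_mem _ _ hX

/-- Generic flatness passes from all finite `B`-modules to all finite `B[X]`-modules. -/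
lemma polynomial {A B : Type*} [CommRing A] {p : Ideal A} [p.IsPrime] [CommRing B]
    [IsNoetherianRing B] [Algebra A B]
    (h : ∀ (M : Type u) [AddCommGroup M] [Module A M] [Module B M] [IsScalarTower A B M]
      [Module.Finite B M], GenericallyFlat p M)
    (M : Type u) [AddCommGroup M] [Module A M] [Module B[X] M] [IsScalarTower A B[X] M]
    [Module.Finite B[X] M] : GenericallyFlat p M := by
  let : Module B M := Module.compHom M (C : B →+* B[X])
  have : IsScalarTower B B[X] M := ⟨fun b q m ↦ by
    change (b • q) • m = C b • q • m
    rw [smul_smul, smul_eq_C_mul]⟩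
  have : IsScalarTower A B M := ⟨fun a b m ↦ by
    change C (a • b) • m = a • C b • m
    rw [← smul_C, smul_assoc]⟩
  obtain ⟨s, hs⟩ := Module.Finite.fg_top (R := B[X]) (M := M)
  let N : Submodule B M := Submodule.span B s
  have hN : Submodule.span B[X] (N : Set M) = ⊤ :=
    top_le_iff.mp (hs.ge.trans (Submodule.span_mono Submodule.subset_span))
  have : Module.Finite B N := Module.Finite.span_finset B s
  let φ (k : ℕ) : N →ₗ[B] M :=
    Algebra.lsmul B B M (X ^ (k + 1) : B[X]) ∘ₗ N.subtype
  -- `K k` consists of the `n` with `X ^ (k + 1) • n` already in stage `k`, so `N ⧸ K k` is the next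
  -- graded piece. Multiplication by `X` gives `K k ≤ K (k + 1)`.
  let K : ℕ →o Submodule B N :=
    ⟨fun k ↦ (powFiltration N k).comap (φ k), monotone_nat_of_le_succ fun k n hn ↦ by
      have := X_smul_mem_powFiltration (N := N) (Submodule.mem_comap.mp hn)
      rw [Submodule.mem_comap]
      convert this using 1
      simp [φ, pow_succ' _ (k + 1)]⟩
  obtain ⟨k₀, hk₀⟩ := monotone_stabilizes_iff_noetherian.mpr (inferInstance : IsNoetherian B N) K
  -- `a` handles stage `0`; `b` handles the quotients up to `k₀`, after which they repeat.
  obtain ⟨a, ha, hN_flat⟩ := h N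
  obtain ⟨b, hb, hK_flat⟩ := exists_forall_of_finite (p := p)
    (fun k : Fin (k₀ + 1) ↦ N ⧸ K k) fun k ↦ h _
  have hquot (k : ℕ) : Module.Flat A (LocalizedModule (.powers (a * b)) (N ⧸ K k)) := by
    obtain hk | hk := le_total k k₀
    · have := hK_flat ⟨k, Nat.lt_succ_of_le hk⟩
      exact Flat.localizedModule_of_dvd (Dvd.intro_left a rfl)
    · rw [← hk₀ k hk]
      have := hK_flat ⟨k₀, Nat.lt_succ_self _⟩
      exact Flat.localizedModule_of_dvd (Dvd.intro_left a rfl)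
  have hfilt (k : ℕ) :
      Module.Flat A (LocalizedModule (.powers (a * b)) (powFiltration N k)) := by
    induction k with
    | zero =>
      have : Module.Flat A (LocalizedModule (.powers (a * b)) N) :=
        Flat.localizedModule_of_dvd (Dvd.intro b rfl)
      exact this
    | succ k ih =>
      have : Module.Flat A (LocalizedModule (.powers (a * b))
          (N ⧸ (powFiltration N k).comap (φ k))) :=
        hquot k
      exact Flat.localizedModule_sup_range _ (powFiltration N k) (φ k)
  refine ⟨a * b, fun hab ↦ (Ideal.IsPrime.mem_or_mem ‹_› hab).elim ha hb, ?_⟩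
  exact Flat.localizedModule_of_iUnion _ (fun k ↦ (powFiltration N k).restrictScalars A)
    (fun _ _ hkl ↦ powFiltration_mono N hkl) (exists_mem_powFiltration hN) hfilt

end Polynomial

/-- Induction on the number of variables; that `A_p` is a field matters only for `n = 0`, where `M`
is finite over `A`. -/
lemma mvPolynomial [IsNoetherianRing A] [p.IsPrime] (hp : IsField (Localization.AtPrime p))
    (n : ℕ) (M : Type u) [AddCommGroup M] [Module A M] [Module (MvPolynomial (Fin n) A) M]
    [IsScalarTower A (MvPolynomial (Fin n) A) M] [Module.Finite (MvPolynomial (Fin n) A) M] :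
    GenericallyFlat p M := by
  induction n generalizing M with
  | zero =>
    have : Module.Finite A (MvPolynomial (Fin 0) A) :=
      .equiv (MvPolynomial.isEmptyAlgEquiv A (Fin 0)).symm.toLinearEquiv
    have : Module.Finite A M := .trans (MvPolynomial (Fin 0) A) M
    exact of_finite hp M
  | succ n ih =>
    let e := MvPolynomial.finSuccEquiv A n
    let : Module (Polynomial (MvPolynomial (Fin n) A)) M := Module.compHom M e.symm.toRingHom
    have hsmul (q : Polynomial (MvPolynomial (Fin n) A)) (m : M) : q • m = e.symm q • m := rfl
    have : IsScalarTower A (Polynomial (MvPolynomial (Fin n) A)) M :=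
      ⟨fun a q m ↦ by rw [hsmul, hsmul, map_smul, smul_assoc]⟩
    have : Module.Finite (Polynomial (MvPolynomial (Fin n) A)) M := by
      obtain ⟨s, hs⟩ := Module.Finite.fg_top (R := MvPolynomial (Fin (n + 1)) A) (M := M)
      refine ⟨s, top_le_iff.mp fun m _ ↦ ?_⟩
      have hm : m ∈ Submodule.span (MvPolynomial (Fin (n + 1)) A) (s : Set M) := hs ▸ trivial
      induction hm using Submodule.span_induction with
      | mem x hx => exact Submodule.subset_span hx
      | zero => exact zero_mem _
      | add x y _ _ hx hy => exact add_mem (hx trivial) (hy trivial)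
      | smul q x _ hx =>
        have := Submodule.smul_mem _ (e q) (hx trivial)
        rwa [hsmul, AlgEquiv.symm_apply_apply] at this
    exact polynomial (B := MvPolynomial (Fin n) A) (fun M ↦ ih M) M

/-- **Generic flatness**: a finite module over an `A`-algebra of finite type is generically flat
at every prime of the Noetherian ring `A` whose local ring is a field. -/
theorem of_finiteType [IsNoetherianRing A] [p.IsPrime] (hp : IsField (Localization.AtPrime p))
    {B : Type*} [CommRing B] [Algebra A B] [Algebra.FiniteType A B]
    (M : Type u) [AddCommGroup M] [Module A M] [Module B M] [IsScalarTower A B M]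
    [Module.Finite B M] : GenericallyFlat p M := by
  obtain ⟨n, π, hπ⟩ := Algebra.FiniteType.iff_quotient_mvPolynomial''.mp ‹Algebra.FiniteType A B›
  let := π.toRingHom.toAlgebra
  let : Module (MvPolynomial (Fin n) A) M := Module.compHom M π.toRingHom
  have : IsScalarTower (MvPolynomial (Fin n) A) B M := ⟨fun q b m ↦ mul_smul (π q) b m⟩
  have : IsScalarTower A (MvPolynomial (Fin n) A) M := ⟨fun a q m ↦ by
    change π (a • q) • m = a • π q • m
    rw [map_smul, smul_assoc]⟩
  have : Module.Finite (MvPolynomial (Fin n) A) B :=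
    .of_surjective (Algebra.linearMap _ B) hπ
  have : Module.Finite (MvPolynomial (Fin n) A) M := .trans B M
  exact mvPolynomial hp n M

end GenericallyFlat

end Module

/-- A reduced local ring of dimension zero is a field. -/
lemma Localization.AtPrime.isField_of_mem_minimalPrimes {A : Type*} [CommRing A]
    [_root_.IsReduced A] {p : Ideal A} [p.IsPrime] (hp : p ∈ minimalPrimes A) : IsField (Localization.AtPrime p) := by
  have : Ring.KrullDimLE 0 (Localization.AtPrime p) := .of_isLocalization p hp _
  have : _root_.IsReduced (Localization.AtPrime p) :=
    isReduced_localizationPreserves p.primeCompl _ inferInstance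
  exact Ring.KrullDimLE.isField_of_isReduced

/-! ### Stalks of modules and restriction -/

namespace AlgebraicGeometry.Scheme.Modules

variable {X Y : Scheme.{u}}

lemma exists_germ_eq_germ_eq (F : X.Modules) (x : X)
    (r : X.presheaf.stalk x) (m : ↑(TopCat.Presheaf.stalk F.presheaf x)) :
    ∃ (W : X.Opens) (hx : x ∈ W) (s : Γ(X, W)) (t : Γ(F, W)),
      X.presheaf.germ W x hx s = r ∧ TopCat.Presheaf.germ F.presheaf W x hx t = m := by
  obtain ⟨U₁, h₁, s, rfl⟩ := X.presheaf.exists_germ_eq r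
  obtain ⟨U₂, h₂, t, rfl⟩ := TopCat.Presheaf.exists_germ_eq F.presheaf m
  refine ⟨U₁ ⊓ U₂, ⟨h₁, h₂⟩,
    X.presheaf.map (homOfLE inf_le_left).op s,
    F.presheaf.map (homOfLE inf_le_right).op t, ?_, ?_⟩
  · exact X.presheaf.germ_res_apply _ _ _ _
  · exact TopCat.Presheaf.germ_res_apply F.presheaf _ _ _ _

/-- An isomorphism of modules induces linear equivalences on stalks. -/
noncomputable def stalkLinearEquiv {F G : X.Modules} (e : F ≅ G) (x : X) :
    ↑(TopCat.Presheaf.stalk F.presheaf x) ≃ₗ[X.presheaf.stalk x]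
      ↑(TopCat.Presheaf.stalk G.presheaf x) where
  __ := ((TopCat.Presheaf.stalkFunctor Ab.{u} x).mapIso
    ((toPresheaf X).mapIso e)).addCommGroupIsoToAddEquiv
  map_smul' r m := by
    obtain ⟨W, hx, s, t, rfl, rfl⟩ := exists_germ_eq_germ_eq F x r m
    have key (t : Γ(F, W)) :
        (TopCat.Presheaf.stalkFunctor Ab.{u} x).map e.hom.mapPresheaf
          (TopCat.Presheaf.germ F.presheaf W x hx t) =
        TopCat.Presheaf.germ G.presheaf W x hx (e.hom.app W t) :=
      TopCat.Presheaf.stalkFunctor_map_germ_apply ..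
    rw [← germ_smul_stalk]
    refine (key _).trans ?_
    rw [Hom.app_smul, germ_smul_stalk]
    exact congrArg (fun z : ↑(TopCat.Presheaf.stalk G.presheaf x) ↦ X.presheaf.germ W x hx s • z)
      (key t).symm

/-- The stalk of a restriction along an open immersion. -/
noncomputable def restrictStalkAddEquiv (F : Y.Modules) (g : X ⟶ Y) [IsOpenImmersion g] (x : X) :
    ↑(TopCat.Presheaf.stalk (F.restrict g).presheaf x) ≃+
      ↑(TopCat.Presheaf.stalk F.presheaf (g x)) :=
  ((restrictStalkNatIso g x).app F).addCommGroupIsoToAddEquiv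

lemma restrictStalkAddEquiv_germ (F : Y.Modules) (g : X ⟶ Y) [IsOpenImmersion g] (x : X)
    (W : X.Opens) (hx : x ∈ W) (t : Γ(F.restrict g, W)) :
    restrictStalkAddEquiv F g x (TopCat.Presheaf.germ (F.restrict g).presheaf W x hx t) =
      TopCat.Presheaf.germ F.presheaf (g ''ᵁ W) (g x) (by simpa using hx)
        ((F.restrictAppIso g W).hom t) :=
  congr($(germ_restrictStalkNatIso_hom_app g x F hx) t)

lemma stalkMap_germ_appIso_inv (g : X ⟶ Y) [IsOpenImmersion g] (x : X)
    (W : X.Opens) (hx : x ∈ W) (s : Γ(X, W)) :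
    g.stalkMap x (Y.presheaf.germ (g ''ᵁ W) (g x) (by simpa using hx) ((g.appIso W).inv s)) =
      X.presheaf.germ W x hx s := by
  rw [Scheme.Hom.germ_stalkMap_apply]
  refine Eq.trans ?_ (X.presheaf.germ_res_apply (eqToHom (g.preimage_image_eq W)) x
    (by simpa using hx) s)
  exact congr(X.presheaf.germ _ x _ ($(g.appIso_inv_app W) s))

lemma restrictStalkAddEquiv_smul (F : Y.Modules) (g : X ⟶ Y) [IsOpenImmersion g] (x : X)
    (r : Y.presheaf.stalk (g x)) (m : ↑(TopCat.Presheaf.stalk (F.restrict g).presheaf x)) :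
    restrictStalkAddEquiv F g x (g.stalkMap x r • m) = r • restrictStalkAddEquiv F g x m := by
  obtain ⟨W, hx, s, t, hs, rfl⟩ := exists_germ_eq_germ_eq (F.restrict g) x
    (g.stalkMap x r) m
  have hr : r = Y.presheaf.germ (g ''ᵁ W) (g x) (by simpa using hx) ((g.appIso W).inv s) := by
    apply (ConcreteCategory.bijective_of_isIso (g.stalkMap x)).injective
    rw [stalkMap_germ_appIso_inv g x W hx, hs]
  rw [← hs, ← germ_smul_stalk, restrictStalkAddEquiv_germ, restrictStalkAddEquiv_germ, hr,
    ← germ_smul_stalk]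
  rfl

end AlgebraicGeometry.Scheme.Modules

/-- The coefficients of a relation lift along `σ`, and a trivialization over `R` maps back. It
compares stalks over different local rings. -/
lemma Module.Flat.of_semilinear_addEquiv {R R' E E' : Type*} [CommRing R] [CommRing R']
    [AddCommGroup E] [Module R E] [AddCommGroup E'] [Module R' E'] (σ : R →+* R')
    (hσ : Function.Surjective σ) (e : E ≃+ E') (he : ∀ (r : R) (m : E), e (r • m) = σ r • e m)
    [Module.Flat R E] : Module.Flat R' E' := by
  refine of_forall_isTrivialRelation fun {l f x} hfx ↦ ?_
  choose g hg using fun i ↦ hσ (f i)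
  have hgx : ∑ i, g i • e.symm (x i) = 0 := e.injective (by simp [he, hg, hfx])
  obtain ⟨k, a, y, hy, ha⟩ := isTrivialRelation_of_sum_smul_eq_zero hgx
  refine ⟨k, fun i j ↦ σ (a i j), fun j ↦ e (y j), fun i ↦ ?_, fun j ↦ ?_⟩
  · simpa [he] using congr(e $(hy i))
  · simpa [hg] using congr(σ $(ha j))

/-- Let `E` be a localization of a `C`-module `M` over a ring `L` which is a localization
of `C` and of a `C`-algebra `B`, and let `N` be the base change of `M` to `B`. If `N_a` is flat
over `A` for some `a ∈ A` which is a unit in `L`, then `E` is flat over `A`. -/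
lemma Module.Flat.of_isLocalizedModule_of_isBaseChange {A B C L M N E : Type*} [CommRing A]
    [CommRing B] [CommRing C] [CommRing L] [Algebra A B] [Algebra C B] [Algebra A L] [Algebra B L]
    [Algebra C L] [IsScalarTower A B L] [IsScalarTower C B L]
    [AddCommGroup M] [Module C M] [AddCommGroup E] [Module A E] [Module B E] [Module C E]
    [Module L E] [IsScalarTower A L E] [IsScalarTower B L E] [IsScalarTower C L E]
    [AddCommGroup N] [Module A N] [Module B N] [Module C N] [IsScalarTower A B N]
    [IsScalarTower C B N]
    (S : Submonoid C) (T : Submonoid B) [IsLocalization S L] [IsLocalization T L]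
    (φ : M →ₗ[C] E) [IsLocalizedModule S φ] {j : M →ₗ[C] N} (hj : IsBaseChange B j)
    (a : A) (ha : IsUnit (algebraMap A L a))
    [Module.Flat A (LocalizedModule (.powers a) N)] : Module.Flat A E := by
  have : IsScalarTower A B E := .to₁₂₄ A B L E
  have : IsScalarTower C B E := .to₁₂₄ C B L E
  have hφ : IsBaseChange L φ := (isLocalizedModule_iff_isBaseChange S L φ).mp inferInstance
  -- Transitivity of base change, `L ⊗_C M ≃ L ⊗_B (B ⊗_C M)`, makes `E` a localization of `N` at
  -- `T` too.
  have hψ : IsBaseChange L (hj.lift φ) := .of_comp hj (by rwa [hj.lift_comp])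
  have : IsLocalizedModule T (hj.lift φ) := (isLocalizedModule_iff_isBaseChange T L _).mpr hψ
  refine of_isLocalizedModule_of_away T (hj.lift φ) a ?_
  rw [Module.End.isUnit_iff]
  have hbij := (Module.End.isUnit_iff _).mp (ha.map (algebraMap L (Module.End L E)))
  convert hbij using 1
  ext m
  simp

namespace AlgebraicGeometry.Scheme.Modules

variable {X Y : Scheme.{u}}

lemma IsFlatAt.restrict {X' Y' : Scheme.{u}} {f : X ⟶ Y} {F : X.Modules} (g : X' ⟶ X) (h : Y' ⟶ Y)
    (f' : X' ⟶ Y') [IsOpenImmersion g] [IsOpenImmersion h] (comm : g ≫ f = f' ≫ h) (x : X')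
    (H : IsFlatAt f F (g x)) : IsFlatAt f' (F.restrict g) x := by
  have hpt : f (g x) = h (f' x) := by
    rw [← Scheme.Hom.comp_apply, comm, Scheme.Hom.comp_apply]
  -- The points `f (g x)` and `h (f' x)` are only propositionally equal, hence the transport by
  -- `stalkSpecializes`.
  let σ : Y.presheaf.stalk (f (g x)) ⟶ Y'.presheaf.stalk (f' x) :=
    Y.presheaf.stalkSpecializes (specializes_of_eq hpt.symm) ≫ h.stalkMap (f' x)
  have hσ : f.stalkMap (g x) ≫ g.stalkMap x = σ ≫ f'.stalkMap x := by
    have := Scheme.Hom.stalkMap_congr_hom _ _ comm x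
    rw [Scheme.Hom.stalkMap_comp, Scheme.Hom.stalkMap_comp] at this
    rw [this, Category.assoc]
    rfl
  have hσ_surj : Function.Surjective σ := by
    refine (ConcreteCategory.bijective_of_isIso (h.stalkMap (f' x))).surjective.comp ?_
    exact (ConcreteCategory.bijective_of_isIso
      (Y.presheaf.stalkCongr (.of_eq hpt)).hom).surjective
  let : Module (Y.presheaf.stalk (f (g x))) ↑(TopCat.Presheaf.stalk F.presheaf (g x)) :=
    Module.compHom _ (f.stalkMap (g x)).hom
  let : Module (Y'.presheaf.stalk (f' x)) ↑(TopCat.Presheaf.stalk (F.restrict g).presheaf x) :=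
    Module.compHom _ (f'.stalkMap x).hom
  have : Module.Flat (Y.presheaf.stalk (f (g x))) ↑(TopCat.Presheaf.stalk F.presheaf (g x)) := H
  refine Module.Flat.of_semilinear_addEquiv σ.hom hσ_surj (restrictStalkAddEquiv F g x).symm
    fun r m ↦ ?_
  rw [AddEquiv.symm_apply_eq]
  have hr : f'.stalkMap x (σ r) = g.stalkMap x (f.stalkMap (g x) r) := congr($hσ.symm r)
  change f.stalkMap (g x) r • m = restrictStalkAddEquiv F g x
    (f'.stalkMap x (σ r) • (restrictStalkAddEquiv F g x).symm m)
  rw [hr, restrictStalkAddEquiv_smul, AddEquiv.apply_symm_apply]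

lemma exists_isLocalizedModule_stalk_tilde {R : CommRingCat.{u}} (M : ModuleCat.{u} R)
    (y : Spec R) :
    letI : Module R ↑(TopCat.Presheaf.stalk (tilde M).presheaf y) :=
      Module.compHom _ ((Scheme.ΓSpecIso R).inv ≫ (Spec R).presheaf.germ ⊤ y trivial).hom
    ∃ φ : M →ₗ[R] ↑(TopCat.Presheaf.stalk (tilde M).presheaf y),
      IsLocalizedModule (@Ideal.primeCompl _ _ (PrimeSpectrum.asIdeal y) y.isPrime) φ :=
  ⟨(tilde.toStalk M y).hom,
    tilde.instIsLocalizedModuleCarrierCarrierOfCarrierStalkAbPresheafPrimeComplAsIdealHomToStalk M y⟩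

/-- Compose `M_y ≃ (M^~)_y ≃ (F|_U)_y ≃ F_x`, where `y` is the point of `Spec Γ(X, U)` over `x`. -/
lemma exists_isLocalizedModule_stalk {U : X.Opens} (hU : IsAffineOpen U) {F : X.Modules}
    {M : ModuleCat.{u} Γ(X, U)} (e : F.restrict hU.fromSpec ≅ tilde M) (x : X) (hx : x ∈ U) :
    letI : Module Γ(X, U) ↑(TopCat.Presheaf.stalk F.presheaf x) :=
      Module.compHom _ (X.presheaf.germ U x hx).hom
    ∃ φ : M →ₗ[Γ(X, U)] ↑(TopCat.Presheaf.stalk F.presheaf x),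
      IsLocalizedModule (hU.primeIdealOf ⟨x, hx⟩).asIdeal.primeCompl φ := by
  obtain ⟨y, hy⟩ : ∃ y : Spec Γ(X, U), y = hU.primeIdealOf ⟨x, hx⟩ := ⟨_, rfl⟩
  have hxy : hU.fromSpec y = x := hy ▸ hU.fromSpec_primeIdealOf ⟨x, hx⟩
  rw [← hy]
  clear hy
  subst hxy
  let : Module Γ(X, U) ↑(TopCat.Presheaf.stalk F.presheaf (hU.fromSpec y)) :=
    Module.compHom _ (X.presheaf.germ U (hU.fromSpec y) hx).hom
  let ρ := (Scheme.ΓSpecIso Γ(X, U)).inv ≫ (Spec Γ(X, U)).presheaf.germ ⊤ y trivial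
  have hρ : X.presheaf.germ U (hU.fromSpec y) hx ≫ hU.fromSpec.stalkMap y = ρ := by
    rw [Scheme.Hom.germ_stalkMap, hU.fromSpec_app_self, Category.assoc]
    exact congr(_ ≫ $((Spec Γ(X, U)).presheaf.germ_res _ y hx))
  let : Module Γ(X, U) ↑(TopCat.Presheaf.stalk (tilde M).presheaf y) := Module.compHom _ ρ.hom
  let ε : ↑(TopCat.Presheaf.stalk (tilde M).presheaf y) ≃ₗ[Γ(X, U)]
      ↑(TopCat.Presheaf.stalk F.presheaf (hU.fromSpec y)) :=
    { __ := (stalkLinearEquiv e y).symm.toAddEquiv.trans (restrictStalkAddEquiv F hU.fromSpec y)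
      map_smul' c m := by
        change restrictStalkAddEquiv F hU.fromSpec y ((stalkLinearEquiv e y).symm (ρ c • m)) =
          X.presheaf.germ U (hU.fromSpec y) hx c • restrictStalkAddEquiv F hU.fromSpec y
            ((stalkLinearEquiv e y).symm m)
        rw [_root_.map_smul, ← restrictStalkAddEquiv_smul, ← hρ]
        rfl }
  obtain ⟨φ, hφ⟩ := exists_isLocalizedModule_stalk_tilde M y
  exact ⟨ε.toLinearMap ∘ₗ φ, .of_linearEquiv _ _ ε⟩

end AlgebraicGeometry.Scheme.Modules

/-! ### From modules to schemes -/

namespace AlgebraicGeometry.Scheme.Modules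

/-- Generic flatness over an affine open `W` of the base, on an affine open `V` of the source
contained in an affine open `U` on which the sheaf is associated with a finite module. -/
lemma exists_notMem_forall_isFlatAt {X Y : Scheme.{u}} (f : X ⟶ Y) [LocallyOfFiniteType f]
    {F : X.Modules} {W : Y.Opens} (hW : IsAffineOpen W) [IsNoetherianRing Γ(Y, W)]
    {p : Ideal Γ(Y, W)} [p.IsPrime] (hp : IsField (Localization.AtPrime p))
    {U V : X.Opens} (hU : IsAffineOpen U) (hV : IsAffineOpen V) (hVU : V ≤ U) (hVW : V ≤ f ⁻¹ᵁ W)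
    (M : ModuleCat.{u} Γ(X, U)) [Module.Finite Γ(X, U) M]
    (e : F.restrict hU.fromSpec ≅ tilde M) :
    ∃ a ∉ p, ∀ x ∈ V, f x ∈ Y.basicOpen a → IsFlatAt f F x := by
  let : Algebra Γ(Y, W) Γ(X, V) := (f.appLE W V hVW).hom.toAlgebra
  let : Algebra Γ(X, U) Γ(X, V) := (X.presheaf.map (homOfLE hVU).op).hom.toAlgebra
  have : Algebra.FiniteType Γ(Y, W) Γ(X, V) := f.finiteType_appLE hW hV hVW
  -- `F` is described by `M` only on `U`, while finite type needs `V`, which maps into `W`. Base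
  -- change to `Γ(X, V)` avoids identifying `F` on `V`.
  obtain ⟨a, hap, hflat⟩ :=
    Module.GenericallyFlat.of_finiteType hp (B := Γ(X, V)) (TensorProduct Γ(X, U) Γ(X, V) M)
  refine ⟨a, hap, fun x hx hxa ↦ ?_⟩
  let := X.presheaf.algebra_section_stalk ⟨x, hVU hx⟩
  let := X.presheaf.algebra_section_stalk ⟨x, hx⟩
  let := Y.presheaf.algebra_section_stalk ⟨f x, hVW hx⟩
  let : Algebra Γ(Y, W) (X.presheaf.stalk x) :=
    (Y.presheaf.germ W (f x) (hVW hx) ≫ f.stalkMap x).hom.toAlgebra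
  have := hU.isLocalization_stalk ⟨x, hVU hx⟩
  have := hV.isLocalization_stalk ⟨x, hx⟩
  have := hW.isLocalization_stalk ⟨f x, hVW hx⟩
  have : IsScalarTower Γ(X, U) Γ(X, V) (X.presheaf.stalk x) := .of_algebraMap_eq fun c ↦
    (X.presheaf.germ_res_apply (homOfLE hVU) x hx c).symm
  have : IsScalarTower Γ(Y, W) Γ(X, V) (X.presheaf.stalk x) := .of_algebraMap_eq fun c ↦
    (f.germ_stalkMap_apply W x (hVW hx) c).trans
      (X.presheaf.germ_res_apply (homOfLE hVW) x hx (f.app W c)).symm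
  let E := ↑(TopCat.Presheaf.stalk F.presheaf x)
  let : Module Γ(X, U) E := Module.compHom _ (X.presheaf.germ U x (hVU hx)).hom
  let : Module Γ(X, V) E := Module.compHom _ (X.presheaf.germ V x hx).hom
  let : Module Γ(Y, W) E :=
    Module.compHom _ (Y.presheaf.germ W (f x) (hVW hx) ≫ f.stalkMap x).hom
  let : Module (Y.presheaf.stalk (f x)) E := Module.compHom _ (f.stalkMap x).hom
  have : IsScalarTower Γ(X, U) (X.presheaf.stalk x) E := .of_algebraMap_smul fun _ _ ↦ rfl
  have : IsScalarTower Γ(X, V) (X.presheaf.stalk x) E := .of_algebraMap_smul fun _ _ ↦ rfl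
  have : IsScalarTower Γ(Y, W) (X.presheaf.stalk x) E := .of_algebraMap_smul fun _ _ ↦ rfl
  have : IsScalarTower Γ(Y, W) (Y.presheaf.stalk (f x)) E := .of_algebraMap_smul fun _ _ ↦ rfl
  have ha : IsUnit (algebraMap Γ(Y, W) (X.presheaf.stalk x) a) :=
    (((Y.mem_basicOpen a (f x) (hVW hx)).mp hxa).map (f.stalkMap x).hom :)
  obtain ⟨φ, hφ⟩ := exists_isLocalizedModule_stalk hU e x (hVU hx)
  have : Module.Flat Γ(Y, W) E :=
    Module.Flat.of_isLocalizedModule_of_isBaseChange (L := X.presheaf.stalk x)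
      (hU.primeIdealOf ⟨x, hVU hx⟩).asIdeal.primeCompl (hV.primeIdealOf ⟨x, hx⟩).asIdeal.primeCompl
      φ (TensorProduct.isBaseChange Γ(X, U) M Γ(X, V)) a ha
  exact (Module.flat_iff_of_isLocalization (Y.presheaf.stalk (f x))
    (hW.primeIdealOf ⟨f x, hVW hx⟩).asIdeal.primeCompl E).mpr this

end AlgebraicGeometry.Scheme.Modules

theorem mainTheorem9 {X Y : Scheme.{u}} (f : X ⟶ Y) [IsNoetherian X] [IsNoetherian Y]
    [IsReduced Y] [Nonempty Y] [LocallyOfFiniteType f] [QuasiCompact f]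
    (F : X.Modules) (hF : F.IsCoherent) :
    ∃ U : Y.Opens, (U : Set Y).Nonempty ∧
      Scheme.Modules.IsFlatOver (f ∣_ U) (F.restrict (f ⁻¹ᵁ U).ι) := by
  obtain ⟨y⟩ := ‹Nonempty Y›
  obtain ⟨W, hW, hyW, -⟩ := exists_isAffineOpen_mem_and_subset (Opens.mem_top y)
  have : IsNoetherianRing Γ(Y, W) := IsLocallyNoetherian.component_noetherian ⟨W, hW⟩
  have : Nonempty W := ⟨⟨y, hyW⟩⟩
  obtain ⟨p, hp⟩ := Ideal.nonempty_minimalPrimes (I := (⊥ : Ideal Γ(Y, W))) bot_ne_top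
  have : p.IsPrime := hp.1.1
  have hfield := Localization.AtPrime.isField_of_mem_minimalPrimes hp
  obtain ⟨a, hap, ha⟩ : ∃ a ∉ p, ∀ x ∈ f ⁻¹ᵁ W, f x ∈ Y.basicOpen a → F.IsFlatAt f x := by
    have hcompact : IsCompact ((f ⁻¹ᵁ W : X.Opens) : Set X) := NoetherianSpace.isCompact _
    -- Finite unions are handled by products of witnesses, which avoid `p` because it is prime.
    refine hcompact.induction_on
      (p := fun s ↦ ∃ a ∉ p, ∀ x ∈ s, f x ∈ Y.basicOpen a → F.IsFlatAt f x)
      ⟨1, p.one_notMem, by simp⟩ ?_ ?_ ?_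
    · rintro s t hst ⟨a, hap, ha⟩
      exact ⟨a, hap, fun x hx ↦ ha x (hst hx)⟩
    · rintro s t ⟨a, hap, ha⟩ ⟨b, hbp, hb⟩
      refine ⟨a * b, fun h ↦ (Ideal.IsPrime.mem_or_mem ‹_› h).elim hap hbp, fun x hx hxab ↦ ?_⟩
      rw [Scheme.basicOpen_mul] at hxab
      exact hx.elim (fun h ↦ ha x h hxab.1) (fun h ↦ hb x h hxab.2)
    · intro x hx
      obtain ⟨U, hU, hxU, M, hM, ⟨e⟩⟩ := hF x
      obtain ⟨V, hV, hxV, hVU⟩ := exists_isAffineOpen_mem_and_subset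
        (show x ∈ U ⊓ f ⁻¹ᵁ W from ⟨hxU, hx⟩)
      exact ⟨V, mem_nhdsWithin_of_mem_nhds (V.2.mem_nhds hxV),
        Scheme.Modules.exists_notMem_forall_isFlatAt f hW hfield hU hV (hVU.trans inf_le_left)
          (hVU.trans inf_le_right) M e⟩
  refine ⟨Y.basicOpen a, ?_, fun x ↦ ?_⟩
  -- On a reduced scheme an empty `D(a)` forces `a = 0`, contradicting `a ∉ p`.
  · rw [Set.nonempty_iff_ne_empty]
    intro h
    refine hap ?_
    rw [(basicOpen_eq_bot_iff a).mp (Opens.ext h)]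
    exact p.zero_mem
  · exact Scheme.Modules.IsFlatAt.restrict _ (Y.basicOpen a).ι _ (morphismRestrict_ι f _).symm x
      (ha _ (Y.basicOpen_le a x.2) x.2)
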